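/- Let $\mathbb{F}$ be a field, let $N \ge 1$ and $d \ge 0$ be integers, and let $E$ be the natural $2$-dimensional representation of $\mathrm{SL}_2(\mathbb{F})$, with standard basis $X, Y$. For $c \ge 0$ let $\mathrm{Sym}^c E$ be the symmetric power (a quotient of $E^{\otimes c}$), with basis the monomials $X^{c-i}Y^i$, $0 \le i \le c$. For a representation $V$ of $\mathrm{SL}_2(\mathbb{F})$ let $\Delta^{(2,1^{N-1})}V$ be the kernel of the multiplication map \[ \textstyle\bigwedge^N V \otimes V \to \bigwedge^{N+1} V, \qquad v_1 \wedge \cdots \wedge v_N \otimes w \mapsto v_1 \wedge \cdots \wedge v_N \wedge w, \] a subrepresentation of $\bigwedge^N V \otimes V$. For $\mathbf{i} = (i_1,\ldots,i_r) \in \{0,1,\ldots,c\}^r$ put $|\mathbf{i}| = i_1 + \cdots + i_r$ and \[ F^{(c)}_\wedge(\mathbf{i}) = X^{c-i_1}Y^{i_1} \wedge \cdots \wedge X^{c-i_r}Y^{i_r} \in \textstyle\bigwedge^r \mathrm{Sym}^c E. \] Let \[ \phi : \mathrm{Sym}^{N-1}E \otimes \textstyle\bigwedge^{N+1}\mathrm{Sym}^{d+1}E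 \to \bigwedge^N \mathrm{Sym}^d E \otimes \mathrm{Sym}^d E \] be the $\mathbb{F}$-linear map defined on the canonical basis by \[ \phi\bigl( X^{N-1-s}Y^s \otimes F^{(d+1)}_\wedge(\mathbf{k}) \bigr) = \sum_{\mathbf{i}} F^{(d)}_\wedge(\mathbf{i}) \otimes X^{d-j(\mathbf{i})}Y^{j(\mathbf{i})}, \qquad j(\mathbf{i}) = s + |\mathbf{k}| - N - |\mathbf{i}|, \] for $0 \le s \le N-1$ and $\mathbf{k} = (k_1,\ldots,k_{N+1})$ with $0 \le k_1 < \cdots < k_{N+1} \le d+1$, where the sum is over all integer tuples $\mathbf{i} = (i_1,\ldots,i_N)$ with $k_\alpha \le i_\alpha < k_{\alpha+1}$ for $1 \le \alpha \le N$; for each of these $0 \le j(\mathbf{i}) \le d$. Then the image of $\phi$ is contained in $\Delta^{(2,1^{N-1})}\mathrm{Sym}^d E$, and $\phi$ is an isomorphism of representations of $\mathrm{SL}_2(\mathbb{F})$ \[ \mathrm{Sym}^{N-1}E \otimes \textstyle\bigwedge^{N+1} \mathrm{Sym}^{d+1}E \;\cong\; \Delta^{(2,1^{N-1})}\mathrm{Sym}^d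 E. \] -/

import Mathlib

open scoped TensorProduct

noncomputable section

namespace Plethysm

/-! ### Symmetric powers -/

section Sym

variable {F : Type*} [Field F] {V W : Type*} [AddCommGroup V] [Module F V]
  [AddCommGroup W] [Module F W]

/-- The symmetric power `Sym^c V`, a quotient of `V^{⊗ c}`, realised as the degree `c` part of the
symmetric algebra of `V`, exactly as Mathlib realises `⋀[F]^c V` inside the exterior algebra. -/
abbrev SymPow (F : Type*) [Field F] (c : ℕ) (V : Type*) [AddCommGroup V] [Module F V] :
    Submodule F (SymmetricAlgebra F V) :=
  LinearMap.range (SymmetricAlgebra.ι F V) ^ c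

/-- The algebra homomorphism `Sym V → Sym W` induced by a linear map `V → W`. -/
def symAlgMap (f : V →ₗ[F] W) : SymmetricAlgebra F V →ₐ[F] SymmetricAlgebra F W :=
  SymmetricAlgebra.lift (SymmetricAlgebra.ι F W ∘ₗ f)

lemma symAlgMap_ι (f : V →ₗ[F] W) (v : V) :
    symAlgMap f (SymmetricAlgebra.ι F V v) = SymmetricAlgebra.ι F W (f v) := by
  simp [symAlgMap]

lemma symAlgMap_mem (c : ℕ) (f : V →ₗ[F] W) (x : SymmetricAlgebra F V) (hx : x ∈ SymPow F c V) :
    symAlgMap f x ∈ SymPow F c W := by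
  have h : (SymPow F c V).map (symAlgMap f).toLinearMap ≤ SymPow F c W := by
    rw [SymPow, Submodule.map_pow]
    refine pow_le_pow_left' ?_ c
    rintro _ ⟨_, ⟨v, rfl⟩, rfl⟩
    exact ⟨f v, (symAlgMap_ι f v).symm⟩
  exact h ⟨x, hx, rfl⟩

/-- The linear map `Sym^c V → Sym^c W` induced by a linear map `V → W`. -/
def symMap (c : ℕ) (f : V →ₗ[F] W) : SymPow F c V →ₗ[F] SymPow F c W :=
  (symAlgMap f).toLinearMap.restrict (symAlgMap_mem c f)

/-- The representation `Sym^c V` of `G`, for a representation `V` of `G`. -/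
def symRep {G : Type*} [Monoid G] (c : ℕ) (ρ : Representation F G V) :
    Representation F G (SymPow F c V) where
  toFun g := symMap c (ρ g)
  map_one' := by
    have h : symAlgMap (ρ 1) = AlgHom.id F (SymmetricAlgebra F V) := by
      ext v; simp [symAlgMap_ι]
    ext x
    change symAlgMap (ρ 1) (x : SymmetricAlgebra F V) = x
    rw [h]; rfl
  map_mul' g g' := by
    have h : symAlgMap (ρ (g * g')) = (symAlgMap (ρ g)).comp (symAlgMap (ρ g')) := by
      ext v; simp [symAlgMap_ι]
    ext x
    change symAlgMap (ρ (g * g')) (x : SymmetricAlgebra F V) = symAlgMap (ρ g) (symAlgMap (ρ g') x)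
    rw [h]; rfl

end Sym

/-! ### Exterior powers and the Schur functor `Δ^{(2,1^{N-1})}` -/

section Delta

variable {F : Type*} [Field F] {V : Type*} [AddCommGroup V] [Module F V] {G : Type*} [Monoid G]

/-- The representation `⋀^n V` of `G`, for a representation `V` of `G`. -/
def extRep (n : ℕ) (ρ : Representation F G V) : Representation F G (⋀[F]^n V) where
  toFun g := exteriorPower.map n (ρ g)
  map_one' := by rw [map_one]; exact exteriorPower.map_id
  map_mul' g g' := by rw [map_mul, Module.End.mul_eq_comp, Module.End.mul_eq_comp, exteriorPower.map_comp]

/-- The multiplication map `μ_N : ⋀^N V ⊗ V → ⋀^{N+1} V`, `x ⊗ w ↦ x ∧ w`. -/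
def mu (F : Type*) [Field F] (N : ℕ) (V : Type*) [AddCommGroup V] [Module F V] :
    (⋀[F]^N V) ⊗[F] V →ₗ[F] ⋀[F]^(N + 1) V :=
  TensorProduct.lift <| LinearMap.mk₂ F
    (fun x w ↦ ⟨(x : ExteriorAlgebra F V) * ExteriorAlgebra.ι F w, by
      rw [ExteriorAlgebra.exteriorPower, pow_succ]
      exact Submodule.mul_mem_mul x.2 ⟨w, rfl⟩⟩)
    (fun x x' w ↦ Subtype.ext (by simp [add_mul]))
    (fun a x w ↦ Subtype.ext (by simp))
    (fun x w w' ↦ Subtype.ext (by simp [mul_add]))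
    (fun a x w ↦ Subtype.ext (by simp))

lemma mu_tmul (N : ℕ) (x : ⋀[F]^N V) (w : V) :
    (mu F N V (x ⊗ₜ w) : ExteriorAlgebra F V) = x * ExteriorAlgebra.ι F w := rfl

/-- The vector space `Δ^{(2,1^{N-1})} V = ker μ_N`. -/
abbrev Delta (F : Type*) [Field F] (N : ℕ) (V : Type*) [AddCommGroup V] [Module F V] :
    Submodule F ((⋀[F]^N V) ⊗[F] V) :=
  LinearMap.ker (mu F N V)

lemma exteriorPower_map_coe (N : ℕ) (f : V →ₗ[F] V) (x : ⋀[F]^N V) :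
    (exteriorPower.map N f x : ExteriorAlgebra F V) = ExteriorAlgebra.map f x := by
  have h : (⋀[F]^N V).subtype ∘ₗ exteriorPower.map N f =
      (ExteriorAlgebra.map f).toLinearMap ∘ₗ (⋀[F]^N V).subtype := by
    ext v
    simp
  exact LinearMap.congr_fun h x

lemma mu_map (N : ℕ) (f : V →ₗ[F] V) :
    mu F N V ∘ₗ TensorProduct.map (exteriorPower.map N f) f =
      exteriorPower.map (N + 1) f ∘ₗ mu F N V := by
  refine TensorProduct.ext' fun x w ↦ Subtype.ext ?_
  simp only [LinearMap.comp_apply, TensorProduct.map_tmul, exteriorPower_map_coe, mu_tmul]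
  simp

/-- The representation `Δ^{(2,1^{N-1})} V` of `G`, for a representation `V` of `G`: the
subrepresentation `ker μ_N` of `⋀^N V ⊗ V`. -/
def deltaRep (N : ℕ) (ρ : Representation F G V) : Representation F G (Delta F N V) :=
  ((extRep N ρ).tprod ρ).subrepresentation (Delta F N V) fun g x hx ↦ by
    rw [Submodule.mem_comap, LinearMap.mem_ker]
    have h := LinearMap.congr_fun (mu_map N (ρ g)) x
    rw [LinearMap.comp_apply, LinearMap.comp_apply, LinearMap.mem_ker.1 hx, map_zero] at h
    exact h

end Delta

/-! ### The natural representation and the map `φ` -/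

section Phi

variable (F : Type*) [Field F]

/-- The underlying space of the natural representation of `SL_2(F)`. -/
abbrev E : Type _ := Fin 2 → F

/-- The natural representation `E` of `SL_2(F)`, by multiplication of column vectors. -/
def natRep : Representation F (Matrix.SpecialLinearGroup (Fin 2) F) (E F) where
  toFun g := Matrix.toLin' (g : Matrix (Fin 2) (Fin 2) F)
  map_one' := by rw [Matrix.SpecialLinearGroup.coe_one]; exact Matrix.toLin'_one
  map_mul' g g' := by rw [Matrix.SpecialLinearGroup.coe_mul]; exact Matrix.toLin'_mul _ _

/-- The first basis vector of `E`, as an element of the symmetric algebra. -/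
def X : SymmetricAlgebra F (E F) := SymmetricAlgebra.ι F (E F) (Pi.single 0 1)

/-- The second basis vector of `E`, as an element of the symmetric algebra. -/
def Y : SymmetricAlgebra F (E F) := SymmetricAlgebra.ι F (E F) (Pi.single 1 1)

lemma range_ι_eq : LinearMap.range (SymmetricAlgebra.ι F (E F)) = Submodule.span F {X F, Y F} := by
  have h : Set.range (Pi.basisFun F (Fin 2)) = {Pi.single 0 1, Pi.single 1 1} := by
    ext v
    simp [Fin.exists_fin_two, eq_comm]
  rw [LinearMap.range_eq_map, ← (Pi.basisFun F (Fin 2)).span_eq, h, Submodule.map_span,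
    Set.image_pair]
  rfl

lemma monomial_mem (c : ℕ) (i : Fin (c + 1)) :
    X F ^ (c - i.val) * Y F ^ i.val ∈ SymPow F c (E F) := by
  have hc : c = (c - i.val) + i.val := by omega
  have h := Submodule.mul_mem_mul
    (Submodule.pow_mem_pow (LinearMap.range (SymmetricAlgebra.ι F (E F))) (x := X F) ⟨_, rfl⟩
      (c - i.val))
    (Submodule.pow_mem_pow (LinearMap.range (SymmetricAlgebra.ι F (E F))) (x := Y F) ⟨_, rfl⟩ i.val)
  rw [← pow_add, ← hc] at h
  exact h

/-- The monomial `X^{c-i} Y^i` in `Sym^c E`, for `0 ≤ i ≤ c`. -/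
def monomial (c : ℕ) (i : Fin (c + 1)) : SymPow F c (E F) :=
  ⟨X F ^ (c - i.val) * Y F ^ i.val, monomial_mem F c i⟩

lemma monomial_linearIndependent (c : ℕ) : LinearIndependent F (monomial F c) := by
  let b := Pi.basisFun F (Fin 2)
  let e := SymmetricAlgebra.equivMvPolynomial b
  let m : Fin (c + 1) → (Fin 2 →₀ ℕ) := fun i ↦
    Finsupp.single 0 (c - i.val) + Finsupp.single 1 i.val
  have hm : Function.Injective m := fun i j hij ↦ by
    have h := DFunLike.congr_fun hij 1
    simpa [m, Fin.val_inj] using h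
  have h := (MvPolynomial.basisMonomials (Fin 2) F).linearIndependent.comp m hm
  have hX : e (X F) = MvPolynomial.X 0 := by
    have := SymmetricAlgebra.equivMvPolynomial_ι_apply b 0
    simpa [b, X, e] using this
  have hY : e (Y F) = MvPolynomial.X 1 := by
    have := SymmetricAlgebra.equivMvPolynomial_ι_apply b 1
    simpa [b, Y, e] using this
  refine LinearIndependent.of_comp (e.toLinearMap ∘ₗ (SymPow F c (E F)).subtype) ?_
  convert! h using 1
  ext1 i
  simp [monomial, hX, hY, m, MvPolynomial.X_pow_eq_monomial, MvPolynomial.monomial_mul]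

lemma mul_mem_span_monomials (c : ℕ) (S : Submodule F (SymmetricAlgebra F (E F)))
    (hS : S = Submodule.span F
      (Set.range fun i : Fin (c + 1) ↦ X F ^ (c - i.val) * Y F ^ i.val)) :
    S * Submodule.span F {X F, Y F} ≤ Submodule.span F
      (Set.range fun i : Fin (c + 2) ↦ X F ^ (c + 1 - i.val) * Y F ^ i.val) := by
  rw [hS, Submodule.span_mul_span]
  refine Submodule.span_mono ?_
  rintro _ ⟨_, ⟨i, rfl⟩, y, hy, rfl⟩
  rcases hy with rfl | rfl
  · refine ⟨i.castSucc, ?_⟩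
    have : c + 1 - i.val = (c - i.val) + 1 := by omega
    simp only [Fin.val_castSucc, this]
    ring
  · refine ⟨i.succ, ?_⟩
    simp only [Fin.val_succ, Nat.add_sub_add_right]
    ring

lemma symPow_le_span (c : ℕ) : SymPow F c (E F) ≤ Submodule.span F
    (Set.range fun i : Fin (c + 1) ↦ X F ^ (c - i.val) * Y F ^ i.val) := by
  induction c with
  | zero => simp [SymPow, Submodule.one_eq_span]
  | succ c ih =>
    rw [SymPow, pow_succ]
    refine (mul_le_mul' ih (range_ι_eq F).le).trans ?_
    exact mul_mem_span_monomials F c _ rfl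

lemma monomial_span (c : ℕ) : ⊤ ≤ Submodule.span F (Set.range (monomial F c)) := by
  rintro ⟨x, hx⟩ -
  have h : (SymPow F c (E F)).subtype '' Set.range (monomial F c) =
      Set.range fun i : Fin (c + 1) ↦ X F ^ (c - i.val) * Y F ^ i.val := by
    rw [← Set.range_comp]; rfl
  have hx' := symPow_le_span F c hx
  rw [← h, ← Submodule.map_span] at hx'
  obtain ⟨y, hy, hyx⟩ := hx'
  have : y = ⟨x, hx⟩ := Subtype.ext hyx
  exact this ▸ hy

/-- The basis of `Sym^c E` of the monomials `X^{c-i} Y^i` for `0 ≤ i ≤ c`. -/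
def symBasis (c : ℕ) : Module.Basis (Fin (c + 1)) F (SymPow F c (E F)) :=
  Module.Basis.mk (monomial_linearIndependent F c) (monomial_span F c)

/-- The element `F_∧^{(c)}(i) = X^{c-i_1}Y^{i_1} ∧ ⋯ ∧ X^{c-i_r}Y^{i_r}` of `⋀^r Sym^c E`. -/
def wedge (c r : ℕ) (i : Fin r → Fin (c + 1)) : ⋀[F]^r (SymPow F c (E F)) :=
  exteriorPower.ιMulti F r fun α ↦ monomial F c (i α)

/-- The basis of `⋀^r Sym^c E` of the `F_∧^{(c)}(k)` for `k` a strictly increasing multi-index. -/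
def wedgeBasis (c r : ℕ) : Module.Basis (Fin r ↪o Fin (c + 1)) F (⋀[F]^r (SymPow F c (E F))) :=
  ((symBasis F c).exteriorPower r).reindex Set.powersetCard.ofFinEmbEquiv.symm

lemma symBasis_apply (c : ℕ) (i : Fin (c + 1)) : symBasis F c i = monomial F c i := by
  simp [symBasis]

lemma wedgeBasis_apply (c r : ℕ) (k : Fin r ↪o Fin (c + 1)) :
    wedgeBasis F c r k = wedge F c r k := by
  simp only [wedgeBasis, Module.Basis.reindex_apply, Equiv.symm_symm, exteriorPower.basis_apply,
    exteriorPower.ιMulti_family, Equiv.symm_apply_apply, wedge]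
  congr 1
  ext1 α
  exact symBasis_apply F c (k α)

/-- The element `F(i, j) = F_∧^{(d)}(i) ⊗ X^{d-j}Y^j` of `⋀^N Sym^d E ⊗ Sym^d E`. -/
def FElt (d N : ℕ) (i : Fin N → Fin (d + 1)) (j : Fin (d + 1)) :
    (⋀[F]^N (SymPow F d (E F))) ⊗[F] SymPow F d (E F) :=
  wedge F d N i ⊗ₜ monomial F d j

/-- The box `B(k) = [k_1,k_2) × ⋯ × [k_N,k_{N+1})`, a set of multi-indices with `N` entries in
`{0,…,d}`, for `k` a strictly increasing multi-index with `N + 1` entries in `{0,…,d+1}`. -/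
def box {d N : ℕ} (k : Fin (N + 1) ↪o Fin (d + 2)) : Finset (Fin N → Fin (d + 1)) :=
  Finset.univ.filter fun i ↦
    ∀ α : Fin N, (k α.castSucc).val ≤ (i α).val ∧ (i α).val < (k α.succ).val

lemma sum_add_le_of_mem_box {d N : ℕ} {k : Fin (N + 1) ↪o Fin (d + 2)} {i : Fin N → Fin (d + 1)}
    (hi : i ∈ box k) : N + ∑ α, (i α).val ≤ ∑ α, (k α).val := by
  have h : ∑ α : Fin N, ((i α).val + 1) ≤ ∑ α : Fin N, (k α.succ).val :=
    Finset.sum_le_sum fun α _ ↦ ((Finset.mem_filter.1 hi).2 α).2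
  rw [Finset.sum_add_distrib] at h
  rw [Fin.sum_univ_succ]
  simp only [Finset.sum_const, Finset.card_univ, Fintype.card_fin, smul_eq_mul, mul_one] at h
  omega

/-- If `i ∈ B(k)` then `s + |k| - N - |i|` lies in `{0,…,d}`; by `sum_add_le_of_mem_box` the
subtraction of natural numbers is not truncated. -/
lemma index_lt {d N : ℕ} (hN : 1 ≤ N) (s : Fin (N - 1 + 1)) {k : Fin (N + 1) ↪o Fin (d + 2)}
    {i : Fin N → Fin (d + 1)} (hi : i ∈ box k) :
    s.val + (∑ α, (k α).val) - N - ∑ α, (i α).val < d + 1 := by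
  have h : ∑ α : Fin N, (k α.castSucc).val ≤ ∑ α : Fin N, (i α).val :=
    Finset.sum_le_sum fun α _ ↦ ((Finset.mem_filter.1 hi).2 α).1
  rw [Fin.sum_univ_castSucc]
  have := (k (Fin.last N)).isLt
  have := s.isLt
  omega

/-- The linear map `φ : Sym^{N-1} E ⊗ ⋀^{N+1} Sym^{d+1} E → ⋀^N Sym^d E ⊗ Sym^d E` with
`φ(X^{N-1-s}Y^s ⊗ F_∧^{(d+1)}(k)) = ∑_{i ∈ B(k)} F(i, s + |k| - N - |i|)` for `0 ≤ s ≤ N - 1` and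
`k` strictly increasing. -/
def phi (N d : ℕ) (hN : 1 ≤ N) :
    SymPow F (N - 1) (E F) ⊗[F] (⋀[F]^(N + 1) (SymPow F (d + 1) (E F))) →ₗ[F]
      (⋀[F]^N (SymPow F d (E F))) ⊗[F] SymPow F d (E F) :=
  ((symBasis F (N - 1)).tensorProduct (wedgeBasis F (d + 1) (N + 1))).constr F fun p ↦
    ∑ i : box p.2, FElt F d N i.1
      ⟨p.1.val + (∑ α, (p.2 α).val) - N - ∑ α, (i.1 α).val, index_lt hN p.1 i.2⟩

lemma tensorBasis_apply (N d : ℕ) (s : Fin (N - 1 + 1)) (k : Fin (N + 1) ↪o Fin (d + 2)) :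
    (symBasis F (N - 1)).tensorProduct (wedgeBasis F (d + 1) (N + 1)) (s, k) =
      monomial F (N - 1) s ⊗ₜ wedge F (d + 1) (N + 1) k := by
  rw [Module.Basis.tensorProduct_apply, symBasis_apply, wedgeBasis_apply]

lemma phi_basis (N d : ℕ) (hN : 1 ≤ N) (s : Fin (N - 1 + 1)) (k : Fin (N + 1) ↪o Fin (d + 2)) :
    phi F N d hN ((symBasis F (N - 1)).tensorProduct (wedgeBasis F (d + 1) (N + 1)) (s, k)) =
      ∑ i : box k, FElt F d N i.1
        ⟨s.val + (∑ α, (k α).val) - N - ∑ α, (i.1 α).val, index_lt hN s i.2⟩ :=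
  Module.Basis.constr_basis _ _ _ _

lemma phi_apply (N d : ℕ) (hN : 1 ≤ N) (s : Fin (N - 1 + 1)) (k : Fin (N + 1) ↪o Fin (d + 2)) :
    phi F N d hN (monomial F (N - 1) s ⊗ₜ wedge F (d + 1) (N + 1) k) =
      ∑ i : box k, FElt F d N i.1
        ⟨s.val + (∑ α, (k α).val) - N - ∑ α, (i.1 α).val, index_lt hN s i.2⟩ := by
  rw [← tensorBasis_apply, phi_basis]

end Phi

end Plethysm

end

/-!
Forms of degree `c` are evaluated at points `p_0, …, p_N` of the plane over an extension field of
`F`. At generic points of the form `(1, x_β)`, evaluation turns `F_∧(k)` into the alternant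
`det (x_β ^ k_α)`, and alternants are linearly independent, so that evaluation separates the
elements of the source and of the target of `φ`. The sum over interlacing tuples which defines `φ`
is the branching rule for alternants; hence, up to sign, evaluating `φ(t)` with the last factor at
`p_β` and the exterior factor at the other points amounts to evaluating `t` at `p_β` and all the
points, and dividing by the product of the brackets `[p_γ, p_β]`, `γ ≠ β`. As the brackets are
invariants of `SL_2`, the map `φ` is equivariant, and it is injective because evaluation is.
Expanding a determinant along the row of the last factor, `φ(t)` is in the kernel of multiplication
by the Lagrange identity `∑_β x_β ^ s / ∏_{γ ≠ β} (x_β - x_γ) = 0` for `s < N`. Finally, the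
dimensions agree.
-/

noncomputable section

namespace Plethysm

open Finset TensorProduct

/-! ### Alternants -/

section Alternant

variable {A : Type*} [CommRing A]

/-- The generalised Vandermonde determinant `det (x_β ^ k_α)`. -/
def alternant {n : ℕ} (k : Fin n → ℕ) (x : Fin n → A) : A :=
  (Matrix.of fun α β ↦ x β ^ k α).det

lemma det_sum_mul_pow {n : ℕ} (s : Fin n → Finset ℕ) (w : Fin n → ℕ → A) (x : Fin n → A) :
    (Matrix.of fun α β ↦ ∑ i ∈ s α, w α i * x β ^ i).det =
      ∑ i ∈ Fintype.piFinset s, (∏ α, w α (i α)) * alternant i x := by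
  have h := Matrix.detRowAlternating.toMultilinearMap.map_sum_finset
    (fun (α : Fin n) i β ↦ w α i * x β ^ i) s
  calc
    _ = Matrix.detRowAlternating fun α ↦ ∑ i ∈ s α, fun β ↦ w α i * x β ^ i := by
      refine congrArg Matrix.det (Matrix.ext fun α β ↦ ?_)
      exact (Finset.sum_apply β (s α) fun i γ ↦ w α i * x γ ^ i).symm
    _ = _ := h
    _ = _ := sum_congr rfl fun i _ ↦ Matrix.det_mul_column (fun α ↦ w α (i α)) _

/-- Subtracting from each row the multiple of the previous one that clears column `β` leaves, in
the rows after the first, divided differences `x_γ ^ b - x_γ ^ a x_β ^ (b - a)`. -/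
lemma alternant_eq_mul_det {N : ℕ} {k : Fin (N + 1) → ℕ} (hk : Monotone k) (x : Fin (N + 1) → A)
    (β : Fin (N + 1)) :
    alternant k x = (-1) ^ (β : ℕ) * x β ^ k 0 * (Matrix.of fun α γ : Fin N ↦
      x (β.succAbove γ) ^ k α.succ -
        x (β.succAbove γ) ^ k α.castSucc * x β ^ (k α.succ - k α.castSucc)).det := by
  let B : Matrix (Fin (N + 1)) (Fin (N + 1)) A := Matrix.of <| Fin.cons (fun γ ↦ x γ ^ k 0)
    fun α γ ↦ x γ ^ k α.succ - x γ ^ k α.castSucc * x β ^ (k α.succ - k α.castSucc)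
  have hB (α : Fin N) : B α.succ β = 0 := by
    simp [B, ← pow_add, Nat.add_sub_cancel' (hk α.castSucc_lt_succ.le)]
  have hrow (α : Fin N) (γ : Fin (N + 1)) : x γ ^ k α.succ =
      B α.succ γ + x β ^ (k α.succ - k α.castSucc) * x γ ^ k α.castSucc := by
    simp only [B, Matrix.of_apply, Fin.cons_succ]
    ring
  have hdet : alternant k x = B.det :=
    Matrix.det_eq_of_forall_row_eq_smul_add_pred (fun α ↦ x β ^ (k α.succ - k α.castSucc))
      (fun _ ↦ rfl) hrow
  rw [hdet, Matrix.det_succ_column B β, Fin.sum_univ_succ, sum_eq_zero fun α _ ↦ by simp [hB]]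
  simp only [Fin.val_zero, zero_add, add_zero]
  rfl

/-- The branching rule of alternants: after division by Vandermonde determinants this is the rule
for restricting Schur polynomials from `N + 1` to `N` variables. -/
theorem alternant_branching {N : ℕ} {k : Fin (N + 1) → ℕ} (hk : Monotone k)
    (x : Fin (N + 1) → A) (β : Fin (N + 1)) :
    alternant k x = (-1) ^ (N + β : ℕ) * (∏ γ, (x β - x (β.succAbove γ))) *
      ∑ i ∈ Fintype.piFinset fun α : Fin N ↦ Ico (k α.castSucc) (k α.succ),
        x β ^ (k 0 + ∑ α, (k α.succ - 1 - i α)) * alternant i (x ∘ β.succAbove) := by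
  let D : Matrix (Fin N) (Fin N) A := Matrix.of fun α γ ↦
    ∑ i ∈ Ico (k α.castSucc) (k α.succ), x β ^ (k α.succ - 1 - i) * (x ∘ β.succAbove) γ ^ i
  have hentry (α γ : Fin N) :
      x (β.succAbove γ) ^ k α.succ -
          x (β.succAbove γ) ^ k α.castSucc * x β ^ (k α.succ - k α.castSucc) =
        -(x β - x (β.succAbove γ)) * D α γ := by
    rw [← mul_geom_sum₂_Ico _ _ (hk α.castSucc_lt_succ.le), neg_sub]
    simp only [D, Matrix.of_apply, Function.comp_apply, mul_comm (x β ^ _)]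
  simp only [alternant_eq_mul_det hk x β, hentry, Matrix.det_mul_row, prod_neg, card_fin]
  rw [det_sum_mul_pow _ fun α i ↦ x β ^ (k α.succ - 1 - i)]
  simp only [pow_add, mul_assoc, ← mul_sum, prod_pow_eq_pow_sum]
  ring

end Alternant

section Independence

variable {R : Type*} [CommRing R]

lemma map_alternant {A B : Type*} [CommRing A] [CommRing B] [Algebra R A] [Algebra R B]
    (f : A →ₐ[R] B) {n : ℕ} (k : Fin n → ℕ) (x : Fin n → A) :
    f (alternant k x) = alternant k (f ∘ x) := by
  rw [alternant, AlgHom.map_det]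
  refine congrArg Matrix.det (Matrix.ext fun α β ↦ ?_)
  simp

lemma comp_perm_eq_iff {n : ℕ} {k k' : Fin n ↪o ℕ} {σ : Equiv.Perm (Fin n)} :
    k ∘ σ = k' ↔ σ = 1 ∧ k = k' := by
  refine ⟨fun h ↦ ?_, fun ⟨hσ, hk⟩ ↦ by simp [hσ, hk]⟩
  have hk : (k : Fin n → ℕ) = k' := by
    rw [← StrictMono.range_inj k.strictMono k'.strictMono, ← h, σ.surjective.range_comp]
  exact ⟨Equiv.ext fun β ↦ k.injective (congrFun (h.trans hk.symm) β), DFunLike.coe_injective hk⟩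

open MvPolynomial (coeff) in
lemma coeff_alternant_X {n : ℕ} (k k' : Fin n ↪o ℕ) :
    coeff (Finsupp.equivFunOnFinite.symm k') (alternant k fun β ↦ (.X β : MvPolynomial (Fin n) R)) =
      if k = k' then 1 else 0 := by
  have hprod (e : Fin n → ℕ) : ∏ β, (.X β : MvPolynomial (Fin n) R) ^ e β =
      .monomial (Finsupp.equivFunOnFinite.symm e) 1 := by
    rw [MvPolynomial.monomial_eq, Finsupp.prod_fintype _ _ (by simp)]
    simp
  have hterm (σ : Equiv.Perm (Fin n)) : coeff (Finsupp.equivFunOnFinite.symm k')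
      (∏ β, (.X β : MvPolynomial (Fin n) R) ^ k (σ β)) = if σ = 1 ∧ k = k' then 1 else 0 := by
    rw [hprod fun β ↦ k (σ β), MvPolynomial.coeff_monomial]
    exact if_congr ((Equiv.apply_eq_iff_eq _).trans comp_perm_eq_iff) rfl rfl
  simp only [alternant, Matrix.det_apply, Matrix.of_apply, MvPolynomial.coeff_sum,
    Units.smul_def, MvPolynomial.coeff_smul, hterm]
  rw [sum_eq_single 1 (fun σ _ hσ ↦ by simp [hσ]) (by simp)]
  simp

theorem linearIndependent_alternant {A : Type*} [CommRing A] [Algebra R A] {n : ℕ} {x : Fin n → A}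
    (hx : AlgebraicIndependent R x) :
    LinearIndependent R fun k : Fin n ↪o ℕ ↦ alternant k x := by
  have h : LinearIndependent R fun k : Fin n ↪o ℕ ↦
      alternant k fun β ↦ (.X β : MvPolynomial (Fin n) R) :=
    .of_pairwise_dual_eq_zero_one _
      (fun k ↦ MvPolynomial.lcoeff R (Finsupp.equivFunOnFinite.symm k))
      (fun k k' hk ↦ (coeff_alternant_X k' k).trans (if_neg hk.symm))
      fun k ↦ (coeff_alternant_X k k).trans (if_pos rfl)
  have h' := h.map_injOn (MvPolynomial.aeval x).toLinearMap hx.injOn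
  simpa [Function.comp_def, map_alternant] using h'

end Independence

/-! ### Determinants of linear forms -/

section Forms

variable {F K V W : Type*} [Field F] [Field K] [Algebra F K] [AddCommGroup V] [Module F V]
  [AddCommGroup W] [Module F W]

/-- The linear form on `⋀^r V` with value `det (ℓ_β(v_α))` at `v_1 ∧ ⋯ ∧ v_r`, for linear forms
`ℓ_1, …, ℓ_r` on `V` with values in an extension `K` of `F`. -/
def detForm {r : ℕ} (ℓ : Fin r → V →ₗ[F] K) : ⋀[F]^r V →ₗ[F] K :=
  exteriorPower.alternatingMapLinearEquiv
    (({ Matrix.detRowAlternating.toMultilinearMap.restrictScalars F with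
        map_eq_zero_of_eq' := fun v _ _ h hij ↦
          (Matrix.detRowAlternating (R := K)).map_eq_zero_of_eq v h hij } :
      (Fin r → K) [⋀^Fin r]→ₗ[F] K).compLinearMap (LinearMap.pi ℓ))

lemma detForm_ιMulti {r : ℕ} (ℓ : Fin r → V →ₗ[F] K) (v : Fin r → V) :
    detForm ℓ (exteriorPower.ιMulti F r v) = (Matrix.of fun α β ↦ ℓ β (v α)).det := by
  rw [detForm, exteriorPower.alternatingMapLinearEquiv_apply_ιMulti]
  rfl

lemma detForm_comp_map {r : ℕ} (ℓ : Fin r → W →ₗ[F] K) (f : V →ₗ[F] W) :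
    detForm ℓ ∘ₗ exteriorPower.map r f = detForm fun β ↦ ℓ β ∘ₗ f := by
  ext v
  simp [detForm_ιMulti]

lemma detForm_smul {r : ℕ} (a : Fin r → K) (ℓ : Fin r → V →ₗ[F] K) :
    detForm (fun β ↦ a β • ℓ β) = (∏ β, a β) • detForm ℓ := by
  ext v
  simpa [detForm_ιMulti] using Matrix.det_mul_row a (Matrix.of fun α β ↦ ℓ β (v α))

/-- The linear form on `V ⊗ W` with value `f(v) g(w)` at `v ⊗ w`. -/
def tensorForm (f : V →ₗ[F] K) (g : W →ₗ[F] K) : V ⊗[F] W →ₗ[F] K :=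
  LinearMap.mul' F K ∘ₗ TensorProduct.map f g

lemma tensorForm_tmul (f : V →ₗ[F] K) (g : W →ₗ[F] K) (v : V) (w : W) :
    tensorForm f g (v ⊗ₜ w) = f v * g w := by
  simp [tensorForm]

lemma tensorForm_map {V' W' : Type*} [AddCommGroup V'] [Module F V'] [AddCommGroup W'] [Module F W']
    (f : V →ₗ[F] K) (g : W →ₗ[F] K) (a : V' →ₗ[F] V) (b : W' →ₗ[F] W) (t : V' ⊗[F] W') :
    tensorForm f g (TensorProduct.map a b t) = tensorForm (f ∘ₗ a) (g ∘ₗ b) t := by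
  simp only [tensorForm, TensorProduct.map_comp, LinearMap.comp_apply]

lemma tensorForm_smul_smul (a b : K) (f : V →ₗ[F] K) (g : W →ₗ[F] K) :
    tensorForm (a • f) (b • g) = (a * b) • tensorForm f g := by
  ext v w
  simp [tensorForm_tmul, mul_mul_mul_comm]

lemma tensorForm_comm (f : V →ₗ[F] K) (g : W →ₗ[F] K) (t : V ⊗[F] W) :
    tensorForm g f (TensorProduct.comm F V W t) = tensorForm f g t := by
  induction t with
  | zero => simp
  | tmul v w => simp [tensorForm_tmul, mul_comm]
  | add x y hx hy => simp [hx, hy]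

lemma mu_ιMulti_tmul {N : ℕ} (v : Fin N → V) (w : V) :
    mu F N V (exteriorPower.ιMulti F N v ⊗ₜ w) =
      exteriorPower.ιMulti F (N + 1) (Fin.snoc v w : Fin (N + 1) → V) := by
  refine Subtype.ext ?_
  rw [mu_tmul, exteriorPower.ιMulti_apply_coe, exteriorPower.ιMulti_apply_coe,
    ExteriorAlgebra.ιMulti_apply, ExteriorAlgebra.ιMulti_apply, List.ofFn_succ',
    List.concat_eq_append, List.prod_append]
  simp

lemma mu_surjective (N : ℕ) : Function.Surjective (mu F N V) := by
  rw [← LinearMap.range_eq_top, eq_top_iff, ← exteriorPower.ιMulti_span, Submodule.span_le]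
  rintro _ ⟨v, rfl⟩
  refine ⟨exteriorPower.ιMulti F N (Fin.init v) ⊗ₜ v (Fin.last N), ?_⟩
  rw [mu_ιMulti_tmul, Fin.snoc_init_self]

/-- Expansion of the determinant along the row of the last factor. -/
lemma detForm_mu {N : ℕ} (ℓ : Fin (N + 1) → V →ₗ[F] K) (t : (⋀[F]^N V) ⊗[F] V) :
    detForm ℓ (mu F N V t) = ∑ β : Fin (N + 1),
      (-1) ^ (N + β : ℕ) * tensorForm (detForm (ℓ ∘ β.succAbove)) (ℓ β) t := by
  suffices h : detForm ℓ ∘ₗ mu F N V = ∑ β : Fin (N + 1),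
      (-1 : K) ^ (N + β : ℕ) • tensorForm (detForm (ℓ ∘ β.succAbove)) (ℓ β) by
    simpa using LinearMap.congr_fun h t
  ext v w
  suffices h : (Matrix.of fun α β ↦ ℓ β ((Fin.snoc v w : Fin (N + 1) → V) α)).det =
      ∑ β : Fin (N + 1),
        (-1) ^ (N + β : ℕ) * ((Matrix.of fun α γ ↦ ℓ (β.succAbove γ) (v α)).det * ℓ β w) by
    simpa [mu_ιMulti_tmul, detForm_ιMulti, tensorForm_tmul] using h
  rw [Matrix.det_succ_row _ (Fin.last N)]
  refine sum_congr rfl fun β _ ↦ ?_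
  have hminor : (Matrix.of fun α β ↦ ℓ β ((Fin.snoc v w : Fin (N + 1) → V) α)).submatrix
      (Fin.last N).succAbove β.succAbove = Matrix.of fun α γ ↦ ℓ (β.succAbove γ) (v α) := by
    ext α γ
    simp [Fin.succAbove_last]
  rw [hminor, Matrix.of_apply, Fin.snoc_last, Fin.val_last, mul_assoc, mul_comm (ℓ β w)]

end Forms

/-! ### Evaluation of binary forms -/

section Eval

variable (F : Type*) {K : Type*} [Field F] [Field K] [Algebra F K]

/-- Evaluation of binary forms of degree `c` over `F` at a point of `K²`. -/
def evalForm (c : ℕ) (p : Fin 2 → K) : SymPow F c (E F) →ₗ[F] K :=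
  (SymmetricAlgebra.lift (Fintype.linearCombination F p)).toLinearMap ∘ₗ
    (SymPow F c (E F)).subtype

lemma evalForm_monomial (c : ℕ) (p : Fin 2 → K) (i : Fin (c + 1)) :
    evalForm F c p (monomial F c i) = p 0 ^ (c - i : ℕ) * p 1 ^ (i : ℕ) := by
  simp [evalForm, monomial, X, Y, Fintype.linearCombination_apply]

lemma evalForm_smul (c : ℕ) (a : K) (p : Fin 2 → K) :
    evalForm F c (a • p) = a ^ c • evalForm F c p := by
  refine (symBasis F c).ext fun i ↦ ?_
  simp only [symBasis_apply, evalForm_monomial, LinearMap.smul_apply, Pi.smul_apply, smul_eq_mul]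
  rw [mul_pow, mul_pow, mul_mul_mul_comm, ← pow_add, Nat.sub_add_cancel i.is_le]

lemma evalForm_comp_symRep (c : ℕ) (p : Fin 2 → K) (g : Matrix.SpecialLinearGroup (Fin 2) F) :
    evalForm F c p ∘ₗ symRep c (natRep F) g =
      evalForm F c (Matrix.vecMul p (g.1.map (algebraMap F K))) := by
  have h : (SymmetricAlgebra.lift (Fintype.linearCombination F p)).comp (symAlgMap (natRep F g)) =
      SymmetricAlgebra.lift (Fintype.linearCombination F
        (Matrix.vecMul p (g.1.map (algebraMap F K)))) := by
    ext i
    simp [symAlgMap_ι, natRep, Fintype.linearCombination_apply, Algebra.smul_def, Pi.single_apply,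
      Matrix.vecMul, dotProduct, mul_comm]
  exact LinearMap.ext fun v ↦ DFunLike.congr_fun h v.1

lemma detForm_evalForm_wedge {c r : ℕ} (x : Fin r → K) (k : Fin r → Fin (c + 1)) :
    detForm (fun β ↦ evalForm F c ![1, x β]) (wedge F c r k) = alternant (fun α ↦ (k α : ℕ)) x := by
  simp [wedge, detForm_ιMulti, evalForm_monomial, alternant]

theorem detForm_evalForm_injective (c : ℕ) {r : ℕ} {x : Fin r → K}
    (hx : AlgebraicIndependent F x) :
    Function.Injective (detForm fun β ↦ evalForm F c ![1, x β]) := by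
  have hk : Function.Injective fun k : Fin r ↪o Fin (c + 1) ↦ k.trans (Fin.valOrderEmb (c + 1)) :=
    fun k k' h ↦ DFunLike.ext _ _ fun α ↦ Fin.ext (DFunLike.congr_fun h α)
  refine LinearMap.injective_of_linearIndependent (wedgeBasis F c r).span_eq ?_
  convert! (linearIndependent_alternant hx).comp _ hk using 1
  ext1 k
  simp only [Function.comp_apply, wedgeBasis_apply]
  exact detForm_evalForm_wedge F x k

theorem eq_zero_of_tensorForm_evalForm {W : Type*} [AddCommGroup W] [Module F W] {c : ℕ}
    {x : Fin (c + 1) → K} (hx : Function.Injective x) {f : W →ₗ[F] K} (hf : Function.Injective f)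
    {t : SymPow F c (E F) ⊗[F] W} (ht : ∀ j, tensorForm (evalForm F c ![1, x j]) f t = 0) :
    t = 0 := by
  obtain ⟨w, rfl⟩ := TensorProduct.eq_repr_basis_left (symBasis F c) t
  have hw : (fun i ↦ f (w i)) = 0 :=
    Matrix.eq_zero_of_forall_index_sum_pow_mul_eq_zero hx fun j ↦ by
      simpa [Finsupp.sum_fintype, symBasis_apply, tensorForm_tmul, evalForm_monomial] using ht j
  refine Finset.sum_eq_zero fun i _ ↦ ?_
  have hi : w i = 0 := hf ((congrFun hw i).trans (map_zero f).symm)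
  simp [hi]

end Eval

/-! ### The map `φ` after evaluation -/

section EvalPhi

variable {N d : ℕ}

lemma sum_box {A : Type*} [AddCommMonoid A] (k : Fin (N + 1) ↪o Fin (d + 2))
    (f : (Fin N → ℕ) → A) :
    ∑ i ∈ box k, f (fun α ↦ (i α : ℕ)) =
      ∑ i ∈ Fintype.piFinset fun α : Fin N ↦ Ico (k α.castSucc : ℕ) (k α.succ), f i := by
  refine sum_nbij (fun i α ↦ (i α : ℕ)) (fun i hi ↦ by simpa [box] using hi)
    (fun i _ j _ h ↦ funext fun α ↦ Fin.ext (congrFun h α)) (fun i hi ↦ ?_) fun _ _ ↦ rfl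
  have hi : ∀ α : Fin N, (k α.castSucc : ℕ) ≤ i α ∧ i α < (k α.succ : ℕ) := by simpa using hi
  exact ⟨fun α ↦ ⟨i α, (hi α).2.trans_le (Nat.le_of_lt_succ (k α.succ).isLt)⟩,
    by simpa [box] using hi, rfl⟩

lemma index_eq_of_mem_box (s : ℕ) {k : Fin (N + 1) ↪o Fin (d + 2)} {i : Fin N → Fin (d + 1)}
    (hi : i ∈ box k) :
    s + ∑ α, (k α : ℕ) - N - ∑ α, (i α : ℕ) =
      s + (k 0 + ∑ α : Fin N, ((k α.succ : ℕ) - 1 - i α)) := by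
  have hsides : ∑ α : Fin N, (k α.succ : ℕ) =
      ∑ α : Fin N, ((k α.succ : ℕ) - 1 - i α) + ∑ α, (i α : ℕ) + N := by
    calc
      _ = ∑ α : Fin N, (((k α.succ : ℕ) - 1 - i α) + i α + 1) :=
        sum_congr rfl fun α _ ↦ by have := ((mem_filter.1 hi).2 α).2; omega
      _ = _ := by simp [sum_add_distrib]
  rw [Fin.sum_univ_succ, hsides]
  omega

variable (F : Type*) {K : Type*} [Field F] [Field K] [Algebra F K]

lemma tensorForm_FElt (y : Fin N → K) (z : K) (i : Fin N → Fin (d + 1)) (j : Fin (d + 1)) :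
    tensorForm (detForm fun γ ↦ evalForm F d ![1, y γ]) (evalForm F d ![1, z]) (FElt F d N i j) =
      z ^ (j : ℕ) * alternant (fun α ↦ (i α : ℕ)) y := by
  rw [FElt, tensorForm_tmul, detForm_evalForm_wedge, evalForm_monomial, mul_comm]
  simp

lemma tensorForm_phi_basis (hN : 1 ≤ N) (y : Fin N → K) (z : K) (s : Fin (N - 1 + 1))
    (k : Fin (N + 1) ↪o Fin (d + 2)) :
    tensorForm (detForm fun γ ↦ evalForm F d ![1, y γ]) (evalForm F d ![1, z])
        (phi F N d hN (monomial F (N - 1) s ⊗ₜ wedge F (d + 1) (N + 1) k)) =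
      z ^ (s : ℕ) * ∑ i ∈ Fintype.piFinset fun α : Fin N ↦ Ico (k α.castSucc : ℕ) (k α.succ),
        z ^ (k 0 + ∑ α, ((k α.succ : ℕ) - 1 - i α)) * alternant i y := by
  let f (i : Fin N → ℕ) : K := z ^ (k 0 + ∑ α : Fin N, ((k α.succ : ℕ) - 1 - i α)) * alternant i y
  rw [phi_apply, map_sum]
  calc
    _ = ∑ i : box k, z ^ (s : ℕ) * f fun α ↦ i.1 α := sum_congr rfl fun i _ ↦
      (tensorForm_FElt F y z i.1 _).trans <| by
        simp only [f, index_eq_of_mem_box _ i.2, pow_add, mul_assoc]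
    _ = ∑ i ∈ box k, z ^ (s : ℕ) * f fun α ↦ i α :=
      sum_coe_sort (box k) fun i ↦ z ^ (s : ℕ) * f fun α ↦ i α
    _ = _ := by rw [sum_box k fun i ↦ z ^ (s : ℕ) * f i, mul_sum]

lemma linearMap_ext_monomial_tmul_wedge {m n r : ℕ} {M : Type*} [AddCommMonoid M] [Module F M]
    {f g : SymPow F m (E F) ⊗[F] (⋀[F]^r (SymPow F n (E F))) →ₗ[F] M}
    (h : ∀ (s : Fin (m + 1)) (k : Fin r ↪o Fin (n + 1)),
      f (monomial F m s ⊗ₜ wedge F n r k) = g (monomial F m s ⊗ₜ wedge F n r k)) :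
    f = g := by
  refine ((symBasis F m).tensorProduct (wedgeBasis F n r)).ext fun ⟨s, k⟩ ↦ ?_
  have hb : (symBasis F m).tensorProduct (wedgeBasis F n r) (s, k) =
      monomial F m s ⊗ₜ wedge F n r k :=
    (Module.Basis.tensorProduct_apply ..).trans
      (congrArg₂ _ (symBasis_apply ..) (wedgeBasis_apply ..))
  exact (congrArg f hb).trans ((h s k).trans (congrArg g hb.symm))

theorem tensorForm_phi_affine (hN : 1 ≤ N) (x : Fin (N + 1) → K) (β : Fin (N + 1))
    (t : SymPow F (N - 1) (E F) ⊗[F] (⋀[F]^(N + 1) (SymPow F (d + 1) (E F)))) :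
    (∏ γ, (x β - x (β.succAbove γ))) *
        tensorForm (detForm fun γ ↦ evalForm F d ![1, x (β.succAbove γ)])
          (evalForm F d ![1, x β]) (phi F N d hN t) =
      (-1) ^ (N + β : ℕ) * tensorForm (evalForm F (N - 1) ![1, x β])
        (detForm fun γ ↦ evalForm F (d + 1) ![1, x γ]) t := by
  suffices h : (∏ γ, (x β - x (β.succAbove γ))) •
        (tensorForm (detForm fun γ ↦ evalForm F d ![1, x (β.succAbove γ)])
          (evalForm F d ![1, x β]) ∘ₗ phi F N d hN) =
      (-1 : K) ^ (N + β : ℕ) • tensorForm (evalForm F (N - 1) ![1, x β])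
        (detForm fun γ ↦ evalForm F (d + 1) ![1, x γ]) from LinearMap.congr_fun h t
  refine linearMap_ext_monomial_tmul_wedge F fun s k ↦ ?_
  have hphi := tensorForm_phi_basis F hN (x ∘ β.succAbove) (x β) s k
  have heval : tensorForm (evalForm F (N - 1) ![1, x β])
      (detForm fun γ ↦ evalForm F (d + 1) ![1, x γ])
      (monomial F (N - 1) s ⊗ₜ wedge F (d + 1) (N + 1) k) =
        x β ^ (s : ℕ) * alternant (fun α ↦ (k α : ℕ)) x := by
    rw [tensorForm_tmul, detForm_evalForm_wedge, evalForm_monomial]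
    simp
  have hbranch : (∏ γ, (x β - x (β.succAbove γ))) *
      ∑ i ∈ Fintype.piFinset fun α : Fin N ↦ Ico (k α.castSucc : ℕ) (k α.succ),
        x β ^ (k 0 + ∑ α, ((k α.succ : ℕ) - 1 - i α)) * alternant i (x ∘ β.succAbove) =
      (-1) ^ (N + β : ℕ) * alternant (fun α ↦ (k α : ℕ)) x := by
    rw [alternant_branching (fun _ _ h ↦ k.monotone h) x β, ← mul_assoc, ← mul_assoc, ← mul_pow]
    simp
  refine (congrArg (_ * ·) hphi).trans (.trans ?_ (congrArg (_ * ·) heval).symm)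
  rw [mul_left_comm, hbranch, mul_left_comm]

/-- The product of the brackets `[p_γ, p_β] = p_γ 0 * p_β 1 - p_γ 1 * p_β 0` over all `γ ≠ β`. -/
def bracketProd (p : Fin (N + 1) → Fin 2 → K) (β : Fin (N + 1)) : K :=
  ∏ γ, (p (β.succAbove γ) 0 * p β 1 - p (β.succAbove γ) 1 * p β 0)

theorem tensorForm_phi (hN : 1 ≤ N) {p : Fin (N + 1) → Fin 2 → K} (hp : ∀ γ, p γ 0 ≠ 0)
    (β : Fin (N + 1)) (t : SymPow F (N - 1) (E F) ⊗[F] (⋀[F]^(N + 1) (SymPow F (d + 1) (E F)))) :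
    bracketProd p β *
        tensorForm (detForm fun γ ↦ evalForm F d (p (β.succAbove γ))) (evalForm F d (p β))
          (phi F N d hN t) =
      (-1) ^ (N + β : ℕ) * tensorForm (evalForm F (N - 1) (p β))
        (detForm fun γ ↦ evalForm F (d + 1) (p γ)) t := by
  let x γ := p γ 1 / p γ 0
  let q := ∏ γ, p (β.succAbove γ) 0
  have heval (c : ℕ) (γ : Fin (N + 1)) :
      evalForm F c (p γ) = p γ 0 ^ c • evalForm F c ![1, x γ] := by
    rw [← evalForm_smul]
    refine congrArg _ (funext fun i ↦ ?_)
    fin_cases i <;> simp [x, mul_div_cancel₀ _ (hp γ)]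
  have hbracket : bracketProd p β = q * p β 0 ^ N * ∏ γ, (x β - x (β.succAbove γ)) := by
    have hpow : p β 0 ^ N = ∏ _γ : Fin N, p β 0 := by simp
    rw [hpow, ← prod_mul_distrib, ← prod_mul_distrib]
    refine prod_congr rfl fun γ _ ↦ ?_
    have := hp β
    have := hp (β.succAbove γ)
    simp only [x]
    field_simp
  have hdeg : p β 0 ^ (N - 1) * p β 0 ^ (d + 1) = p β 0 ^ N * p β 0 ^ d := by
    rw [← pow_add, ← pow_add]
    congr 1
    omega
  simp only [heval, detForm_smul, tensorForm_smul_smul, LinearMap.smul_apply, smul_eq_mul,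
    Fin.prod_univ_succAbove _ β, prod_pow, hbracket]
  linear_combination q ^ (d + 1) * p β 0 ^ N * p β 0 ^ d * tensorForm_phi_affine F hN x β t -
    (-1) ^ (N + β : ℕ) * q ^ (d + 1) * tensorForm (evalForm F (N - 1) ![1, x β])
        (detForm fun γ ↦ evalForm F (d + 1) ![1, x γ]) t * hdeg

end EvalPhi

/-! ### Image and kernel of `φ` -/

section Image

variable (F : Type*) [Field F]

/-- The field `F(x_0, x_1, …)` of rational functions, over which forms are evaluated at generic
points. -/
abbrev GenericField : Type _ := FractionRing (MvPolynomial ℕ F)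

/-- The variable `x_n` of the field of rational functions. -/
def genericCoord (n : ℕ) : GenericField F := algebraMap (MvPolynomial ℕ F) _ (MvPolynomial.X n)

lemma algebraicIndependent_genericCoord {ι : Type*} {n : ι → ℕ} (hn : Function.Injective n) :
    AlgebraicIndependent F (genericCoord F ∘ n) :=
  ((MvPolynomial.algebraicIndependent_X ℕ F).map'
    (f := IsScalarTower.toAlgHom F _ (GenericField F)) (IsFractionRing.injective _ _)).comp n hn

lemma sum_pow_div_prod_sub {K : Type*} [Field K] {N : ℕ} {x : Fin (N + 1) → K}
    (hx : Function.Injective x) {s : ℕ} (hs : s < N) :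
    ∑ β, x β ^ s / ∏ γ, (x β - x (β.succAbove γ)) = 0 := by
  have hdeg : (Polynomial.X ^ s : Polynomial K).degree < #(univ : Finset (Fin (N + 1))) := by
    rw [Polynomial.degree_X_pow, card_fin]
    exact_mod_cast hs.trans N.lt_succ_self
  have h := Lagrange.coeff_eq_sum hx.injOn hdeg
  rw [Polynomial.coeff_X_pow, if_neg (by simp; omega)] at h
  rw [h]
  refine sum_congr rfl fun β _ ↦ ?_
  rw [Polynomial.eval_pow, Polynomial.eval_X, ← compl_singleton, ← Fin.image_succAbove_univ,
    prod_image fun _ _ _ _ h ↦ Fin.succAbove_right_injective h]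

variable {K : Type*} [Field K] [Algebra F K]

lemma sum_inv_prod_sub_smul_evalForm {N c : ℕ} (hc : c < N) {x : Fin (N + 1) → K}
    (hx : Function.Injective x) :
    ∑ β, (∏ γ, (x β - x (β.succAbove γ)))⁻¹ • evalForm F c ![1, x β] = 0 := by
  refine (symBasis F c).ext fun i ↦ ?_
  have h := sum_pow_div_prod_sub hx (Nat.lt_of_le_of_lt i.is_le hc)
  simpa [symBasis_apply, evalForm_monomial, div_eq_inv_mul] using h

lemma sum_inv_prod_sub_mul_tensorForm {W : Type*} [AddCommGroup W] [Module F W] {N c : ℕ}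
    (hc : c < N) {x : Fin (N + 1) → K} (hx : Function.Injective x) (f : W →ₗ[F] K)
    (t : SymPow F c (E F) ⊗[F] W) :
    ∑ β, (∏ γ, (x β - x (β.succAbove γ)))⁻¹ * tensorForm (evalForm F c ![1, x β]) f t = 0 := by
  induction t with
  | zero => simp
  | add t t' ht ht' => simp only [map_add, mul_add, sum_add_distrib, ht, ht', add_zero]
  | tmul v w =>
    have h := LinearMap.congr_fun (sum_inv_prod_sub_smul_evalForm F hc hx) v
    simp only [LinearMap.sum_apply, LinearMap.smul_apply, smul_eq_mul] at h
    simp only [tensorForm_tmul, ← mul_assoc, ← sum_mul, h, LinearMap.zero_apply, zero_mul]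

lemma detForm_mu_phi {N d : ℕ} (hN : 1 ≤ N) {x : Fin (N + 1) → K} (hx : Function.Injective x)
    (t : SymPow F (N - 1) (E F) ⊗[F] (⋀[F]^(N + 1) (SymPow F (d + 1) (E F)))) :
    detForm (fun β ↦ evalForm F d ![1, x β]) (mu F N (SymPow F d (E F)) (phi F N d hN t)) = 0 := by
  have hdiv (β : Fin (N + 1)) {a b : K}
      (h : (∏ γ, (x β - x (β.succAbove γ))) * a = (-1) ^ (N + β : ℕ) * b) :
      (-1) ^ (N + β : ℕ) * a = (∏ γ, (x β - x (β.succAbove γ)))⁻¹ * b := by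
    have hne : ∏ γ, (x β - x (β.succAbove γ)) ≠ 0 := prod_ne_zero_iff.2 fun γ _ ↦
      sub_ne_zero.2 fun h ↦ Fin.succAbove_ne β γ (hx h).symm
    rw [eq_inv_mul_iff_mul_eq₀ hne, mul_left_comm, h, ← mul_assoc, ← mul_pow]
    simp
  have hterm (β : Fin (N + 1)) := hdiv β (tensorForm_phi_affine F hN x β t)
  exact (detForm_mu _ _).trans <| (sum_congr rfl fun β _ ↦ hterm β).trans <|
    sum_inv_prod_sub_mul_tensorForm F (by omega) hx _ t

theorem phi_mem_Delta (N d : ℕ) (hN : 1 ≤ N)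
    (t : SymPow F (N - 1) (E F) ⊗[F] (⋀[F]^(N + 1) (SymPow F (d + 1) (E F)))) :
    phi F N d hN t ∈ Delta F N (SymPow F d (E F)) := by
  have hx := algebraicIndependent_genericCoord F (Fin.val_injective (n := N + 1))
  exact LinearMap.mem_ker.2 (detForm_evalForm_injective F d hx
    ((detForm_mu_phi F hN hx.injective t).trans (map_zero _).symm))

lemma tensorForm_evalForm_eq_zero_of_phi_eq_zero {N d : ℕ} {hN : 1 ≤ N}
    {t : SymPow F (N - 1) (E F) ⊗[F] (⋀[F]^(N + 1) (SymPow F (d + 1) (E F)))}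
    (ht : phi F N d hN t = 0) (x : Fin (N + 1) → K) (β : Fin (N + 1)) :
    tensorForm (evalForm F (N - 1) ![1, x β])
      (detForm fun γ ↦ evalForm F (d + 1) ![1, x γ]) t = 0 := by
  have h := tensorForm_phi_affine F hN x β t
  rw [ht] at h
  exact (mul_eq_zero.1 (h.symm.trans (mul_eq_zero_of_right _ (map_zero _)))).resolve_left (by simp)

theorem phi_injective (N d : ℕ) (hN : 1 ≤ N) : Function.Injective (phi F N d hN) := by
  have hx := algebraicIndependent_genericCoord F (Fin.val_injective (n := N + 1))
  have hcast := Fin.castLE_injective (Nat.succ_le_succ (Nat.sub_le N 1))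
  exact (injective_iff_map_eq_zero _).2 fun t ht ↦
    eq_zero_of_tensorForm_evalForm F (hx.injective.comp hcast)
      (detForm_evalForm_injective F (d + 1) hx) fun j ↦
        tensorForm_evalForm_eq_zero_of_phi_eq_zero F ht _ (Fin.castLE (by omega) j)

end Image

/-! ### Equivariance -/

section Equivariance

variable {F K : Type*} [Field F] [Field K] [Algebra F K] {N d : ℕ}

lemma tensorForm_tprod {V W G : Type*} [AddCommGroup V] [Module F V] [AddCommGroup W] [Module F W]
    [Monoid G] {ρ : Representation F G V} {σ : Representation F G W} {g : G} {f f' : V →ₗ[F] K}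
    {h h' : W →ₗ[F] K} (hf : f ∘ₗ ρ g = f') (hh : h ∘ₗ σ g = h') (t : V ⊗[F] W) :
    tensorForm f h ((ρ.tprod σ) g t) = tensorForm f' h' t := by
  rw [← hf, ← hh]
  exact tensorForm_map f h (ρ g) (σ g) t

lemma detForm_comp_extRep {V G : Type*} [AddCommGroup V] [Module F V] [Monoid G] {r : ℕ}
    (ℓ : Fin r → V →ₗ[F] K) (ρ : Representation F G V) (g : G) :
    detForm ℓ ∘ₗ extRep r ρ g = detForm fun β ↦ ℓ β ∘ₗ ρ g :=
  detForm_comp_map ℓ (ρ g)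

lemma detForm_evalForm_comp_extRep (c : ℕ) {r : ℕ} (p : Fin r → Fin 2 → K)
    (g : Matrix.SpecialLinearGroup (Fin 2) F) :
    detForm (fun β ↦ evalForm F c (p β)) ∘ₗ extRep r (symRep c (natRep F)) g =
      detForm fun β ↦ evalForm F c (Matrix.vecMul (p β) (g.1.map (algebraMap F K))) := by
  simp only [detForm_comp_extRep, evalForm_comp_symRep]

lemma bracketProd_vecMul (p : Fin (N + 1) → Fin 2 → K) (β : Fin (N + 1))
    (g : Matrix.SpecialLinearGroup (Fin 2) F) :
    bracketProd (fun γ ↦ Matrix.vecMul (p γ) (g.1.map (algebraMap F K))) β = bracketProd p β := by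
  have hdet := congrArg (algebraMap F K) g.2
  rw [Matrix.det_fin_two, map_sub, map_mul, map_mul, map_one] at hdet
  refine prod_congr rfl fun γ _ ↦ ?_
  simp only [Matrix.vecMul, dotProduct, Fin.sum_univ_two, Matrix.map_apply]
  linear_combination (p (β.succAbove γ) 0 * p β 1 - p (β.succAbove γ) 1 * p β 0) * hdet

lemma vecMul_zero_ne_zero_of_transcendental {z : K} (hz : Transcendental F z)
    (g : Matrix.SpecialLinearGroup (Fin 2) F) :
    Matrix.vecMul ![1, z] (g.1.map (algebraMap F K)) 0 ≠ 0 := by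
  intro h
  have hz' : algebraMap F K (g.1 0 0) + algebraMap F K (g.1 1 0) * z = 0 := by
    simpa [Matrix.vecMul, dotProduct, Fin.sum_univ_two, mul_comm] using h
  let q : Polynomial F := Polynomial.C (g.1 0 0) + Polynomial.C (g.1 1 0) * Polynomial.X
  have hq : q = 0 := transcendental_iff.1 hz q (by simpa [q] using hz')
  have h₀ : g.1 0 0 = 0 := by simpa [q] using congrArg (Polynomial.coeff · 0) hq
  have h₁ : g.1 1 0 = 0 := by simpa [q] using congrArg (Polynomial.coeff · 1) hq
  have hdet := g.2
  rw [Matrix.det_fin_two, h₀, h₁] at hdet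
  simp at hdet

lemma eq_of_tensorForm_evalForm {W : Type*} [AddCommGroup W] [Module F W] {c : ℕ}
    {x : Fin (c + 1) → K} (hx : Function.Injective x) {f : W →ₗ[F] K} (hf : Function.Injective f)
    {t t' : W ⊗[F] SymPow F c (E F)}
    (ht : ∀ j, tensorForm f (evalForm F c ![1, x j]) t = tensorForm f (evalForm F c ![1, x j]) t') :
    t = t' := by
  refine sub_eq_zero.1 ((TensorProduct.comm F _ _).map_eq_zero_iff.1
    (eq_zero_of_tensorForm_evalForm F hx hf fun j ↦ ?_))
  rw [tensorForm_comm, map_sub, ht, sub_self]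

lemma tensorForm_phi_tprod (hN : 1 ≤ N) (g : Matrix.SpecialLinearGroup (Fin 2) F)
    {x : Fin (N + 1) → K} (hx : AlgebraicIndependent F x) (β : Fin (N + 1))
    (t : SymPow F (N - 1) (E F) ⊗[F] (⋀[F]^(N + 1) (SymPow F (d + 1) (E F)))) :
    tensorForm (detForm fun γ ↦ evalForm F d ![1, x (β.succAbove γ)]) (evalForm F d ![1, x β])
        (phi F N d hN (((symRep (N - 1) (natRep F)).tprod
          (extRep (N + 1) (symRep (d + 1) (natRep F)))) g t)) =
      tensorForm (detForm fun γ ↦ evalForm F d ![1, x (β.succAbove γ)]) (evalForm F d ![1, x β])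
        (((extRep N (symRep d (natRep F))).tprod (symRep d (natRep F))) g (phi F N d hN t)) := by
  let p (γ : Fin (N + 1)) : Fin 2 → K := ![1, x γ]
  have hbracket : bracketProd p β ≠ 0 := prod_ne_zero_iff.2 fun γ _ ↦ by
    simpa [p, sub_ne_zero] using fun h ↦ Fin.succAbove_ne β γ (hx.injective h).symm
  have hsource := tensorForm_tprod (evalForm_comp_symRep F (N - 1) (p β) g)
    (detForm_evalForm_comp_extRep (d + 1) p g) t
  have htarget := tensorForm_tprod
    (detForm_evalForm_comp_extRep d (fun γ ↦ p (β.succAbove γ)) g)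
    (evalForm_comp_symRep F d (p β) g) (phi F N d hN t)
  have hphi := tensorForm_phi F hN (p := p) (fun _ ↦ one_ne_zero) β
    (((symRep (N - 1) (natRep F)).tprod (extRep (N + 1) (symRep (d + 1) (natRep F)))) g t)
  have hphi' := tensorForm_phi F hN
    (fun γ ↦ vecMul_zero_ne_zero_of_transcendental (hx.transcendental γ) g) β t
  have hinv := bracketProd_vecMul p β g
  exact mul_left_cancel₀ hbracket <| hphi.trans <| (congrArg (_ * ·) hsource).trans <|
    hphi'.symm.trans <| congrArg₂ _ hinv htarget.symm

theorem phi_tprod (hN : 1 ≤ N) (g : Matrix.SpecialLinearGroup (Fin 2) F)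
    (t : SymPow F (N - 1) (E F) ⊗[F] (⋀[F]^(N + 1) (SymPow F (d + 1) (E F)))) :
    phi F N d hN (((symRep (N - 1) (natRep F)).tprod
        (extRep (N + 1) (symRep (d + 1) (natRep F)))) g t) =
      ((extRep N (symRep d (natRep F))).tprod (symRep d (natRep F))) g (phi F N d hN t) := by
  have hoffset : Function.Injective fun γ : Fin N ↦ d + 1 + (γ : ℕ) :=
    fun γ γ' h ↦ Fin.ext (Nat.add_left_cancel h)
  have hcons (j : Fin (d + 1)) : Function.Injective
      (Fin.cons (j : ℕ) fun γ ↦ d + 1 + (γ : ℕ) : Fin (N + 1) → ℕ) := by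
    refine Fin.cons_injective_iff.2 ⟨?_, hoffset⟩
    rintro ⟨γ, h⟩
    dsimp only at h
    omega
  exact eq_of_tensorForm_evalForm
    (algebraicIndependent_genericCoord F (Fin.val_injective (n := d + 1))).injective
    (detForm_evalForm_injective F d (algebraicIndependent_genericCoord F hoffset)) fun j ↦
      tensorForm_phi_tprod hN g (algebraicIndependent_genericCoord F (hcons j)) 0 t

end Equivariance

/-! ### Dimensions -/

section Dimension

variable {F : Type*} [Field F]

lemma mul_choose_add_choose (n N : ℕ) :
    N * (n + 1).choose (N + 1) + n.choose (N + 1) = n.choose N * n := by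
  have h := Nat.add_one_mul_choose_eq n N
  have hpascal := Nat.choose_succ_succ' n N
  linarith

instance (c : ℕ) : Module.Finite F (SymPow F c (E F)) :=
  Module.Finite.of_basis (symBasis F c)

lemma finrank_symPow (c : ℕ) : Module.finrank F (SymPow F c (E F)) = c + 1 := by
  rw [Module.finrank_eq_card_basis (symBasis F c), Fintype.card_fin]

lemma finrank_Delta_add {V : Type*} [AddCommGroup V] [Module F V] [Module.Finite F V] {n : ℕ}
    (hV : Module.finrank F V = n) (N : ℕ) :
    Module.finrank F (Delta F N V) + n.choose (N + 1) = n.choose N * n := by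
  have h := LinearMap.finrank_range_add_finrank_ker (V := (⋀[F]^N V) ⊗[F] V) (mu F N V)
  rw [LinearMap.range_eq_top.2 (mu_surjective N), finrank_top, exteriorPower.finrank_eq,
    Module.finrank_tensorProduct, exteriorPower.finrank_eq, hV, add_comm] at h
  exact h

lemma finrank_tensor_exteriorPower {V W : Type*} [AddCommGroup V] [Module F V] [Module.Finite F V]
    [AddCommGroup W] [Module F W] [Module.Finite F W] {m n : ℕ} (hV : Module.finrank F V = m)
    (hW : Module.finrank F W = n) (r : ℕ) :
    Module.finrank F (V ⊗[F] (⋀[F]^r W)) = m * n.choose r := by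
  rw [Module.finrank_tensorProduct, exteriorPower.finrank_eq, hV, hW]

theorem finrank_eq_finrank_Delta (F : Type*) [Field F] (N d : ℕ) (hN : 1 ≤ N) :
    Module.finrank F (SymPow F (N - 1) (E F) ⊗[F] (⋀[F]^(N + 1) (SymPow F (d + 1) (E F)))) =
      Module.finrank F (Delta F N (SymPow F d (E F))) := by
  have hsource := finrank_tensor_exteriorPower (finrank_symPow (F := F) (N - 1))
    (finrank_symPow (F := F) (d + 1)) (N + 1)
  have htarget := finrank_Delta_add (finrank_symPow (F := F) d) N
  rw [Nat.sub_add_cancel hN] at hsource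
  rw [← mul_choose_add_choose] at htarget
  exact hsource.trans (Nat.add_right_cancel htarget).symm

lemma codRestrict_bijective {V W : Type*} [AddCommGroup V] [Module F V] [Module.Finite F V]
    [AddCommGroup W] [Module F W] [Module.Finite F W] {S : Submodule F W} {f : V →ₗ[F] W}
    (hS : ∀ v, f v ∈ S) (hf : Function.Injective f)
    (hdim : Module.finrank F V = Module.finrank F S) :
    Function.Bijective (f.codRestrict S hS) :=
  have hinj := (LinearMap.injective_codRestrict_iff hS).2 hf
  ⟨hinj, (LinearMap.injective_iff_surjective_of_finrank_eq_finrank hdim).1 hinj⟩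

theorem codRestrict_phi_bijective (F : Type*) [Field F] (N d : ℕ) (hN : 1 ≤ N) :
    Function.Bijective ((phi F N d hN).codRestrict (Delta F N (SymPow F d (E F)))
      (phi_mem_Delta F N d hN)) :=
  codRestrict_bijective
    (V := SymPow F (N - 1) (E F) ⊗[F] (⋀[F]^(N + 1) (SymPow F (d + 1) (E F))))
    (W := (⋀[F]^N (SymPow F d (E F))) ⊗[F] SymPow F d (E F))
    (phi_mem_Delta F N d hN) (phi_injective F N d hN) (finrank_eq_finrank_Delta F N d hN)

end Dimension

end Plethysm

end

theorem theorem1p1 (F : Type*) [Field F] (N d : ℕ) (hN : 1 ≤ N) :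
    ∃ Φ : Representation.Equiv
        ((Plethysm.symRep (N - 1) (Plethysm.natRep F)).tprod
          (Plethysm.extRep (N + 1) (Plethysm.symRep (d + 1) (Plethysm.natRep F))))
        (Plethysm.deltaRep N (Plethysm.symRep d (Plethysm.natRep F))),
      ∀ x, (Φ x : (⋀[F]^N (Plethysm.SymPow F d (Plethysm.E F))) ⊗[F]
        Plethysm.SymPow F d (Plethysm.E F)) = Plethysm.phi F N d hN x := by
  let e := LinearEquiv.ofBijective _ (Plethysm.codRestrict_phi_bijective F N d hN)
  exact ⟨Representation.Equiv.mk e fun g ↦ LinearMap.ext fun x ↦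
    Subtype.ext (Plethysm.phi_tprod hN g x), fun x ↦ rfl⟩
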